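/- Fix a prime $q$. There are constants $c,d\in\mathbb N$, depending only on $q$, such that the following holds for all $m,n$, every $m\times n$ matrix $A$ over $\mathbb Z_q$ and every $b\in\mathbb Z_q^m$ for which $Ax=b$ has no solution $x\in\mathbb Z_q^n$. Let $w$ be the maximum number of nonzero entries in a row of $A$. Then the explicit encoding of $Ax=b$ has a refutation in Frege with counting axioms modulo $q$ in which every formula has depth at most $d$ and whose size is at most $c\,(m+n+2^w)^c$. That is, the explicit encoding of $Ax=b$ has a constant-depth refutation in Frege with counting axioms modulo $q$ of size polynomial in $m$, $n$ and $2^w$. The notions used are as follows. *Formulas* are built from variables by negation $\neg$ and disjunctions $\bigvee X$ of arbitrary finite lists $X$. FALSE is the empty disjunction, $A\vee B$ is $\bigvee\{A,B\}$, and $\bigwedge_i F_i$ abbreviates $\neg\bigvee_i\neg F_i$. The size of a formula is its number of symbols (occurrences of variables and connectives), and its depth is the nesting depth of its connectives. *Explicit encoding.* The variables $x_1,\dots,x_n$ are Boolean, with FALSE $=0$ and TRUE $=1$. For row $i$ let $T_i=\{j: A_{ij}\neq 0\}$. Let $C_i$ be the CNF consisting, for each $S\subseteq T_i$ with $\sum_{j\in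 S}A_{ij}\neq b_i$, of the clause $\bigvee_{j\in S}\neg x_j\vee\bigvee_{j\in T_i\setminus S}x_j$. Thus $C_i$ is satisfied by a 0/1 assignment iff the $i$-th equation holds. The explicit encoding is the CNF $\bigwedge_{i=1}^m C_i$, that is, the conjunction of the clauses of all the $C_i$. *Counting axioms modulo $q$.* For $N\not\equiv 0 \pmod q$, let $[N]^q$ be the collection of $q$-element subsets of $[N]=\{1,\dots,N\}$, and write $e\perp f$ if $e\ne f$ and $e\cap f\neq\emptyset$. With a variable $x_e$ for each $e\in[N]^q$, $$\mathrm{Count}^{[N]}_q=\bigvee_{v\in[N]}\Big(\bigwedge_{e\in[N]^q,\ e\ni v}\neg x_e\Big)\ \vee\ \bigvee_{e,f\in[N]^q,\ e\perp f}(x_e\wedge x_f).$$ *Refutations.* A refutation of a formula $\Gamma$ in Frege with counting axioms modulo $q$ is a finite sequence of formulas in $x_1,\dots,x_n$ ending in FALSE, each of which is $\Gamma$, or an axiom $A\vee\neg A$, or a substitution instance of $\mathrm{Count}^{[N]}_q$ for some $N\not\equiv0\pmod q$, or follows from earlier formulas by one of the following rules: - weakening: from $A$ infer $A\vee B$; -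 cut: from $A\vee B$ and $\neg A\vee C$ infer $B\vee C$; - merging: from $\bigvee X\vee\bigvee Y$ infer $\bigvee(X\cup Y)$; - unmerging: from $\bigvee(X\cup Y)$ infer $\bigvee X\vee\bigvee Y$. In the last two rules disjunctions are treated as disjunctions of sets (order and repetition are irrelevant), and a one-element disjunction $\bigvee\{A\}$ may be identified with $A$. The size of a refutation is the sum of the sizes of its formulas. -/

import Mathlib

/-- Propositional formulas over the variables `α`, with negation and unbounded fan-in disjunction
as connectives. -/
inductive PropFormula (α : Type) : Type where
  | var : α → PropFormula α
  | neg : PropFormula α → PropFormula α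
  | disj : List (PropFormula α) → PropFormula α

namespace PropFormula

/-- The constant FALSE is the empty disjunction. -/
def falsum {α : Type} : PropFormula α := disj []

/-- The binary disjunction `A ∨ B`. -/
def or {α : Type} (A B : PropFormula α) : PropFormula α := disj [A, B]

/-- The conjunction of a list of formulas, as an abbreviation: `⋀ Fᵢ` is `¬ ⋁ ¬ Fᵢ`. -/
def conj {α : Type} (Fs : List (PropFormula α)) : PropFormula α := neg (disj (Fs.map neg))

/-- The number of symbols of a formula (occurrences of variables and of connectives). -/
def size {α : Type} : PropFormula α → ℕ
  | var _ => 1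
  | neg F => F.size + 1
  | disj Fs => (Fs.map fun F => F.size).sum + 1

/-- The depth of a formula: the nesting depth of its connectives. -/
def depth {α : Type} : PropFormula α → ℕ
  | var _ => 0
  | neg F => F.depth + 1
  | disj Fs => (Fs.map fun F => F.depth).foldr max 0 + 1

/-- Simultaneous substitution of formulas for variables. -/
def subst {α β : Type} (σ : α → PropFormula β) : PropFormula α → PropFormula β
  | var a => σ a
  | neg F => neg (F.subst σ)
  | disj Fs => disj (Fs.map fun F => F.subst σ)

/-- `F` is the disjunction of the list `X`. A disjunction with a single member is identified with
this member, so that every formula `F` is also the disjunction of the one-element list `[F]`. -/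
def IsDisjOf {α : Type} (F : PropFormula α) (X : List (PropFormula α)) : Prop :=
  F = disj X ∨ X = [F]

end PropFormula

namespace CountingFrege

open PropFormula

/-- Two sets conflict if they are different and not disjoint. -/
def Conflict {V : Type} (e f : Finset V) : Prop := e ≠ f ∧ ¬ Disjoint e f

open Classical in
/-- The counting formula modulo `q` on the points `Fin N`, with one variable for each `q`-element
set `e` of points: some point `v` lies in no chosen set, or two chosen sets conflict. -/
noncomputable def countFormula (q N : ℕ) : PropFormula (Finset (Fin N)) :=
  or
    (disj ((Finset.univ : Finset (Fin N)).toList.map fun v =>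
      conj (((Finset.powersetCard q (Finset.univ : Finset (Fin N))).filter
        fun e => v ∈ e).toList.map fun e => neg (var e))))
    (disj (((Finset.powersetCard q (Finset.univ : Finset (Fin N)) ×ˢ
        Finset.powersetCard q (Finset.univ : Finset (Fin N))).filter
        fun p => Conflict p.1 p.2).toList.map fun p => conj [var p.1, var p.2]))

/-- `Step q H prev F`: the formula `F` is a legitimate next line after the lines `prev`, in a
derivation from the hypotheses `H` in the Frege system with counting axioms modulo `q`. -/
inductive Step {α : Type} (q : ℕ) (H : Set (PropFormula α)) (prev : List (PropFormula α)) :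
    PropFormula α → Prop where
  | hypothesis (F : PropFormula α) (hF : F ∈ H) : Step q H prev F
  | excludedMiddle (A : PropFormula α) : Step q H prev (or A (neg A))
  | counting (N : ℕ) (hN : ¬ q ∣ N) (σ : Finset (Fin N) → PropFormula α) :
      Step q H prev ((countFormula q N).subst σ)
  | weakening (A B : PropFormula α) (hA : A ∈ prev) : Step q H prev (or A B)
  | cut (A B C : PropFormula α) (hB : or A B ∈ prev) (hC : or (neg A) C ∈ prev) :
      Step q H prev (or B C)
  | merging (F G K : PropFormula α) (X Y Z : List (PropFormula α))
      (hF : F.IsDisjOf X) (hG : G.IsDisjOf Y) (hK : K.IsDisjOf Z)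
      (hZ : ∀ A, A ∈ Z ↔ A ∈ X ∨ A ∈ Y) (h : or F G ∈ prev) : Step q H prev K
  | unmerging (F G K : PropFormula α) (X Y Z : List (PropFormula α))
      (hF : F.IsDisjOf X) (hG : G.IsDisjOf Y) (hK : K.IsDisjOf Z)
      (hZ : ∀ A, A ∈ Z ↔ A ∈ X ∨ A ∈ Y) (h : K ∈ prev) : Step q H prev (or F G)

/-- A derivation from `H`: every line is justified by the lines strictly before it. -/
def IsDerivation {α : Type} (q : ℕ) (H : Set (PropFormula α)) (π : List (PropFormula α)) : Prop :=
  ∀ (i : ℕ) (hi : i < π.length), Step q H (π.take i) π[i]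

/-- A refutation of `H`: a derivation from `H` whose last line is FALSE. -/
def IsRefutation {α : Type} (q : ℕ) (H : Set (PropFormula α)) (π : List (PropFormula α)) : Prop :=
  IsDerivation q H π ∧ π.getLast? = some falsum

/-- The size of a derivation: its total number of symbols. -/
def derivationSize {α : Type} (π : List (PropFormula α)) : ℕ := (π.map size).sum

end CountingFrege

namespace LinearSystem

open PropFormula

/-- The variables (columns) with a non-zero coefficient in row `i`. -/
def rowSupport {q m n : ℕ} (A : Matrix (Fin m) (Fin n) (ZMod q)) (i : Fin m) : Finset (Fin n) :=
  Finset.univ.filter fun j => A i j ≠ 0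

/-- The maximum number of non-zero entries in a row. -/
def width {q m n : ℕ} (A : Matrix (Fin m) (Fin n) (ZMod q)) : ℕ :=
  Finset.univ.sup fun i => (rowSupport A i).card

/-- The clause over the variables in `T` that excludes exactly the assignments which, on `T`, make
true the variables in `S` and no others. -/
noncomputable def excludingClause {n : ℕ} (T S : Finset (Fin n)) : PropFormula (Fin n) :=
  disj (T.toList.map fun j => if j ∈ S then neg (var j) else var j)

/-- The clauses of the CNF for the `i`-th equation: for each 0/1 assignment to the variables of the
equation (given by the set `S` of its true variables) that violates the equation, the clause that
excludes this assignment. -/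
noncomputable def rowClauses {q m n : ℕ} (A : Matrix (Fin m) (Fin n) (ZMod q)) (b : Fin m → ZMod q)
    (i : Fin m) : List (PropFormula (Fin n)) :=
  ((rowSupport A i).powerset.filter fun S => ∑ j ∈ S, A i j ≠ b i).toList.map
    (excludingClause (rowSupport A i))

/-- The explicit encoding of `A x = b`: the CNF formed by the clauses of all the equations. -/
noncomputable def explicitEncoding {q m n : ℕ} (A : Matrix (Fin m) (Fin n) (ZMod q))
    (b : Fin m → ZMod q) : PropFormula (Fin n) :=
  conj ((List.finRange m).flatMap (rowClauses A b))

end LinearSystem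

/-! ### Size and depth of formulas -/

namespace PropFormula

variable {α : Type}

/-! Since `q` is prime, unsolvability yields a vector y with yᵀA = 0 and y·b ≠ 0
(`exists_row_combination`). Lift residues to 0, …, q-1 and place y_i A_ij points at position (i, j),
and -y_i b_i points at one extra position of each row i. Every column then carries a multiple of q
points, whereas the total N is congruent to -y·b, so q does not divide N. A solution x with 0/1
entries would nevertheless partition all points into q-blocks: column j is partitioned when x_j is
false; in row i, if S is the set of its true variables, the extra points and those in the columns of
S number y_i (∑_{j∈S} A_ij - b_i) ≡ 0 mod q and are partitioned together.

All these partitions are fixed in advance. Whether e is a chosen block is then expressed by a DNF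
whose terms say "x_j is false" or "row i is assigned exactly S" (`exists_partial_assignments`).
Substituting these DNFs into the counting axiom gives a disjunction each of whose members is refuted
locally: conflicting blocks have contradictory terms (`clauseDerives_not_both`), and a point of row
i is covered, by a decision tree on the variables of that row (`clauseDerives_cover`). Cutting the
members away leaves FALSE (`clauseDerives_refute`). The tree costs a factor 2^w, and the number of
q-sets is at most N^q, polynomial because q is fixed; the depth is constant because the DNFs have
bounded depth. -/

theorem size_disj (X : List (PropFormula α)) : (disj X).size = (X.map size).sum + 1 := by
  simp [size]

theorem size_neg (F : PropFormula α) : (neg F).size = F.size + 1 := by simp [size]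

theorem depth_neg (F : PropFormula α) : (neg F).depth = F.depth + 1 := by simp [depth]

theorem size_or (F G : PropFormula α) : (or F G).size = F.size + G.size + 1 := by
  simp [or, size_disj]

theorem depth_disj_le {X : List (PropFormula α)} {d : ℕ} (h : ∀ F ∈ X, F.depth ≤ d) :
    (disj X).depth ≤ d + 1 := by
  simp only [depth, Nat.add_le_add_iff_right]
  induction X with
  | nil => simp
  | cons F X ih =>
    simp only [List.map_cons, List.foldr_cons, max_le_iff]
    exact ⟨h F (by simp), ih fun G hG => h G (by simp [hG])⟩

theorem depth_or_le {F G : PropFormula α} {d : ℕ} (hF : F.depth ≤ d) (hG : G.depth ≤ d) :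
    (or F G).depth ≤ d + 1 :=
  depth_disj_le (by simp [hF, hG])

theorem size_disj_le {X : List (PropFormula α)} {l s : ℕ} (hl : X.length ≤ l)
    (h : ∀ F ∈ X, F.size ≤ s) : (disj X).size ≤ l * s + 1 := by
  rw [size_disj, Nat.add_le_add_iff_right]
  have := List.sum_le_card_nsmul (X.map size) s (by simpa using h)
  simp only [List.length_map, smul_eq_mul] at this
  exact this.trans (Nat.mul_le_mul_right _ hl)

theorem isDisjOf_disj (X : List (PropFormula α)) : (disj X).IsDisjOf X := Or.inl rfl

theorem isDisjOf_singleton (F : PropFormula α) : F.IsDisjOf [F] := Or.inr rfl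

end PropFormula

/-! ### Derivations with bounds on line size, depth and number of lines -/

namespace CountingFrege

open PropFormula

variable {α : Type} {q : ℕ} {H : Set (PropFormula α)}

theorem Step.mono {π ρ : List (PropFormula α)} (h : π ⊆ ρ) {F : PropFormula α}
    (hF : Step q H π F) : Step q H ρ F := by
  cases hF with
  | hypothesis F hF => exact .hypothesis F hF
  | excludedMiddle A => exact .excludedMiddle A
  | counting N hN σ => exact .counting N hN σ
  | weakening A B hA => exact .weakening A B (h hA)
  | cut A B C hB hC => exact .cut A B C (h hB) (h hC)
  | merging F G K X Y Z hF hG hK hZ hh => exact .merging _ _ _ X Y Z hF hG hK hZ (h hh)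
  | unmerging F G K X Y Z hF hG hK hZ hh => exact .unmerging _ _ _ X Y Z hF hG hK hZ (h hh)

theorem IsDerivation.append {π ρ : List (PropFormula α)} (hπ : IsDerivation q H π)
    (hρ : IsDerivation q H ρ) : IsDerivation q H (π ++ ρ) := by
  intro i hi
  rcases lt_or_ge i π.length with h | h
  · rw [List.getElem_append_left h, List.take_append_of_le_length h.le]
    exact hπ i h
  · rw [List.getElem_append_right h]
    refine (hρ (i - π.length) (by simp at hi; omega)).mono ?_
    rw [List.take_append]
    exact List.subset_append_right _ _

theorem IsDerivation.concat {π : List (PropFormula α)} (hπ : IsDerivation q H π)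
    {F : PropFormula α} (hF : Step q H π F) : IsDerivation q H (π ++ [F]) := by
  intro i hi
  rcases lt_or_ge i π.length with h | h
  · rw [List.getElem_append_left h, List.take_append_of_le_length h.le]
    exact hπ i h
  · have : i = π.length := by simp at hi; omega
    subst this
    simpa using hF

theorem IsDerivation.take {π : List (PropFormula α)} (hπ : IsDerivation q H π) (k : ℕ) :
    IsDerivation q H (π.take k) := by
  intro i hi
  have hi' : i < k ∧ i < π.length := by simpa using hi
  rw [List.getElem_take, List.take_take, min_eq_left hi'.1.le]
  exact hπ i hi'.2

/-- `F` is a line of a derivation of at most `L` lines of size at most `B` and depth at most `D`. -/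
def Derives (q : ℕ) (H : Set (PropFormula α)) (B D L : ℕ) (F : PropFormula α) : Prop :=
  ∃ π : List (PropFormula α), IsDerivation q H π ∧ (∀ G ∈ π, G.size ≤ B ∧ G.depth ≤ D) ∧
    π.length ≤ L ∧ F ∈ π

variable {B D L L₁ L₂ : ℕ} {F G K : PropFormula α}

theorem Derives.mono (h : Derives q H B D L₁ F) (hL : L₁ ≤ L₂) : Derives q H B D L₂ F := by
  obtain ⟨π, h1, h2, h3, h4⟩ := h
  exact ⟨π, h1, h2, h3.trans hL, h4⟩

/-- The two derivations are concatenated without sharing, so line counts add up as in a tree-like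
proof. -/
theorem Derives.binary (h₁ : Derives q H B D L₁ F) (h₂ : Derives q H B D L₂ G)
    (hs : K.size ≤ B) (hd : K.depth ≤ D) (h : ∀ π, F ∈ π → G ∈ π → Step q H π K) :
    Derives q H B D (L₁ + L₂ + 1) K := by
  obtain ⟨π, h1, h2, h3, h4⟩ := h₁
  obtain ⟨ρ, k1, k2, k3, k4⟩ := h₂
  refine ⟨π ++ ρ ++ [K], (h1.append k1).concat (h _ (by simp [h4]) (by simp [k4])), ?_, ?_, ?_⟩
  · intro A hA
    simp only [List.mem_append, List.mem_singleton] at hA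
    rcases hA with (hA | hA) | rfl
    exacts [h2 _ hA, k2 _ hA, ⟨hs, hd⟩]
  · simp; omega
  · simp

theorem Derives.axiomatic (hs : K.size ≤ B) (hd : K.depth ≤ D) (h : ∀ π, Step q H π K) :
    Derives q H B D 1 K := by
  refine ⟨[K], ?_, by simp [hs, hd], by simp, by simp⟩
  simpa using IsDerivation.concat (π := []) (fun i hi => by simp at hi) (h [])

theorem Derives.unary (h₁ : Derives q H B D L F)
    (hs : K.size ≤ B) (hd : K.depth ≤ D) (h : ∀ π, F ∈ π → Step q H π K) :
    Derives q H B D (L + 1) K := by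
  obtain ⟨π, h1, h2, h3, h4⟩ := h₁
  refine ⟨π ++ [K], h1.concat (h _ h4), ?_, by simpa using h3, by simp⟩
  intro A hA
  simp only [List.mem_append, List.mem_singleton] at hA
  rcases hA with hA | rfl
  exacts [h2 _ hA, ⟨hs, hd⟩]

/-- A refutation must end in FALSE, while `Derives` only asks that the formula occur; the derivation
is truncated at an occurrence. -/
theorem Derives.exists_refutation (h : Derives q H B D L falsum) :
    ∃ π : List (PropFormula α), IsRefutation q H π ∧ (∀ F ∈ π, F.depth ≤ D) ∧
      derivationSize π ≤ L * B := by
  obtain ⟨π, h1, h2, h3, h4⟩ := h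
  obtain ⟨k, hk, hk'⟩ := List.mem_iff_getElem.1 h4
  have hsub : ∀ F ∈ π.take (k + 1), F ∈ π := fun F hF => List.mem_of_mem_take hF
  refine ⟨π.take (k + 1), ⟨h1.take _, ?_⟩, fun F hF => (h2 F (hsub F hF)).2, ?_⟩
  · rw [List.take_succ_eq_append_getElem hk, hk']
    simp
  · have := List.sum_le_card_nsmul ((π.take (k + 1)).map size) B (by
      intro x hx
      obtain ⟨F, hF, rfl⟩ := List.mem_map.1 hx
      exact (h2 F (hsub F hF)).1)
    refine this.trans ?_
    simp only [List.length_map, smul_eq_mul]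
    exact Nat.mul_le_mul_right _ ((List.length_take_le' _ _).trans h3)

/-! ### A calculus of clauses on top of the Frege rules -/

/-- A clause with at most `l` members, each of size at most `s` and depth at most `d`. -/
def Small (l s d : ℕ) (X : List (PropFormula α)) : Prop :=
  X.length ≤ l ∧ ∀ F ∈ X, F.size ≤ s ∧ F.depth ≤ d

variable {l s d : ℕ} {X Y Z : List (PropFormula α)} {A : PropFormula α}

theorem Small.size_le (h : Small l s d X) : (disj X).size ≤ l * s + 1 :=
  size_disj_le h.1 fun F hF => (h.2 F hF).1

theorem Small.depth_le (h : Small l s d X) : (disj X).depth ≤ d + 1 :=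
  depth_disj_le fun F hF => (h.2 F hF).2

theorem Small.tail (h : Small l s d (A :: X)) : Small l s d X :=
  ⟨(Nat.le_succ _).trans h.1, fun F hF => h.2 F (by simp [hF])⟩

/-- The clause `X` is small and its disjunction has a derivation of at most `L` lines. -/
def ClauseDerives (q : ℕ) (H : Set (PropFormula α)) (l s d L : ℕ) (X : List (PropFormula α)) :
    Prop :=
  Small l s d X ∧ Derives q H (3 * (l * s) + 5) (d + 2) L (disj X)

theorem ClauseDerives.mono (h : ClauseDerives q H l s d L₁ X) (hL : L₁ ≤ L₂) :
    ClauseDerives q H l s d L₂ X :=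
  ⟨h.1, h.2.mono hL⟩

/-- Weakening adjoins the whole of `disj Y` as a second disjunct, and merging absorbs `X` into it.
The bound on `X` leaves room for a concatenation of two small clauses; together with `Y` this
explains the factor 3 in the bound on lines. -/
theorem Derives.weaken (hX : (disj X).size ≤ 2 * (l * s) + 1) (hX' : (disj X).depth ≤ d + 1)
    (h : Derives q H (3 * (l * s) + 5) (d + 2) L (disj X)) (hXY : X ⊆ Y)
    (hY : (disj Y).size ≤ l * s + 1) (hY' : (disj Y).depth ≤ d + 1) :
    Derives q H (3 * (l * s) + 5) (d + 2) (L + 2) (disj Y) := by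
  have h1 := h.unary (K := or (disj X) (disj Y)) (by rw [size_or]; omega)
    (depth_or_le hX' hY') fun π hπ => .weakening _ _ hπ
  exact h1.unary (by omega) (by omega) fun π hπ =>
    .merging _ _ _ X Y Y (isDisjOf_disj _) (isDisjOf_disj _) (isDisjOf_disj _)
      (fun A => ⟨Or.inr, fun h => h.elim (fun h => hXY h) id⟩) hπ

theorem ClauseDerives.weaken (h : ClauseDerives q H l s d L X) (hXY : X ⊆ Y)
    (hY : Small l s d Y) : ClauseDerives q H l s d (L + 2) Y :=
  ⟨hY, h.2.weaken (h.1.size_le.trans (by omega)) h.1.depth_le hXY hY.size_le hY.depth_le⟩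

theorem ClauseDerives.excludedMiddle (hA : A ∈ X) (hA' : neg A ∈ X) (hX : Small l s d X) :
    ClauseDerives q H l s d 3 X := by
  have h1 := hX.2 _ hA
  have h2 := hX.2 _ hA'
  rw [size_neg] at h2
  have hl : 1 ≤ l := (List.length_pos_of_mem hA).trans_le hX.1
  have hs : s ≤ l * s := Nat.le_mul_of_pos_left s hl
  have hsz : (or A (neg A)).size ≤ 2 * (l * s) + 1 := by rw [size_or, size_neg]; omega
  have hdp : (or A (neg A)).depth ≤ d + 1 := depth_or_le h1.2 h2.2
  have h := Derives.axiomatic (q := q) (H := H) (K := or A (neg A)) (B := 3 * (l * s) + 5)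
    (D := d + 2) (by omega) (by omega) fun π => .excludedMiddle A
  exact ⟨hX, h.weaken hsz hdp (by simp [hA, hA']) hX.size_le hX.depth_le⟩

theorem Small.or_size (h : Small l s d (A :: X)) : (or A (disj X)).size ≤ l * s + 2 := by
  have := h.size_le
  rw [size_disj] at this
  rw [size_or, size_disj]
  simp at this
  omega

theorem Small.or_depth (h : Small l s d (A :: X)) : (or A (disj X)).depth ≤ d + 2 :=
  depth_or_le ((h.2 A (by simp)).2.trans (by omega)) h.tail.depth_le

/-- The cut rule needs a binary disjunction with the cut formula on the left; identifying `A` with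
the disjunction of `[A]` allows it to be split off. -/
theorem ClauseDerives.unmerge (h : ClauseDerives q H l s d L (A :: X)) :
    Derives q H (3 * (l * s) + 5) (d + 2) (L + 1) (or A (disj X)) :=
  h.2.unary (h.1.or_size.trans (by omega)) h.1.or_depth fun π hπ =>
    .unmerging _ _ _ [A] X (A :: X) (isDisjOf_singleton _) (isDisjOf_disj _) (isDisjOf_disj _)
      (by simp) hπ

theorem size_disj_append (X Y : List (PropFormula α)) :
    (disj (X ++ Y)).size + 1 = (disj X).size + (disj Y).size := by
  simp only [size_disj, List.map_append, List.sum_append]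
  omega

theorem Derives.merge_weaken (h : Derives q H (3 * (l * s) + 5) (d + 2) L (or (disj X) (disj Y)))
    (hs : (disj X).size + (disj Y).size ≤ 2 * (l * s) + 2)
    (hd : ∀ F ∈ X ++ Y, F.depth ≤ d) (hXZ : X ⊆ Z) (hYZ : Y ⊆ Z) (hZ : Small l s d Z) :
    Derives q H (3 * (l * s) + 5) (d + 2) (L + 3) (disj Z) := by
  have hs' := size_disj_append X Y
  have h1 := h.unary (K := disj (X ++ Y)) (by omega) ((depth_disj_le hd).trans (by omega))
    fun π hπ => .merging _ _ _ X Y (X ++ Y) (isDisjOf_disj _) (isDisjOf_disj _)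
      (isDisjOf_disj _) (by simp) hπ
  exact h1.weaken (by omega) (depth_disj_le hd) (by simp [hXZ, hYZ]) hZ.size_le hZ.depth_le

theorem ClauseDerives.cut (h₁ : ClauseDerives q H l s d L₁ (A :: X))
    (h₂ : ClauseDerives q H l s d L₂ (neg A :: Y)) (hXZ : X ⊆ Z) (hYZ : Y ⊆ Z)
    (hZ : Small l s d Z) : ClauseDerives q H l s d (L₁ + L₂ + 6) Z := by
  have k1 := h₁.1.tail
  have k2 := h₂.1.tail
  have h := h₁.unmerge.binary h₂.unmerge (K := or (disj X) (disj Y))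
    (by rw [size_or]; have := k1.size_le; have := k2.size_le; omega)
    (depth_or_le k1.depth_le k2.depth_le) fun π h1 h2 => .cut A _ _ h1 h2
  refine ⟨hZ, (h.merge_weaken (by have := k1.size_le; have := k2.size_le; omega) ?_ hXZ hYZ
    hZ).mono (by omega)⟩
  intro F hF
  rcases List.mem_append.1 hF with hF | hF
  exacts [(k1.2 F hF).2, (k2.2 F hF).2]

theorem depth_le_of_mem {F : PropFormula α} (hF : F ∈ X) : F.depth + 1 ≤ (disj X).depth := by
  simp only [depth, Nat.add_le_add_iff_right]
  induction X with
  | nil => simp at hF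
  | cons G X ih =>
    simp only [List.map_cons, List.foldr_cons, le_max_iff]
    rcases List.mem_cons.1 hF with rfl | hF
    exacts [Or.inl le_rfl, Or.inr (ih hF)]

/-- After splitting off the member `disj Y`, merging no longer treats it as a single disjunct but
unites its members with the rest. `unflatten` is the converse, and packs members of a clause into
one formula. -/
theorem ClauseDerives.flatten (h : ClauseDerives q H l s d L (disj Y :: X)) (hXZ : X ⊆ Z)
    (hYZ : Y ⊆ Z) (hZ : Small l s d Z) : ClauseDerives q H l s d (L + 4) Z := by
  have h1 := h.1.or_size
  rw [size_or] at h1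
  refine ⟨hZ, h.unmerge.merge_weaken (by omega) ?_ hYZ hXZ hZ⟩
  intro F hF
  rcases List.mem_append.1 hF with hF | hF
  · have := depth_le_of_mem hF
    have := (h.1.2 (disj Y) (by simp)).2
    omega
  · exact (h.1.2 F (by simp [hF])).2

theorem ClauseDerives.unflatten (h : ClauseDerives q H l s d L X) (hX : X ⊆ Y ++ Z)
    (hZ : Small l s d (disj Y :: Z)) : ClauseDerives q H l s d (L + 4) (disj Y :: Z) := by
  have h1 := hZ.or_size
  rw [size_or] at h1
  have h2 := size_disj_append Y Z
  have h3 : (disj (Y ++ Z)).depth ≤ d + 1 := by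
    refine depth_disj_le fun F hF => ?_
    rcases List.mem_append.1 hF with hF | hF
    · have := depth_le_of_mem hF
      have := (hZ.2 (disj Y) (by simp)).2
      omega
    · exact (hZ.2 F (by simp [hF])).2
  have k1 := h.2.weaken (h.1.size_le.trans (by omega)) h.1.depth_le hX (by omega) h3
  have k2 := k1.unary (K := or (disj Y) (disj Z)) (hZ.or_size.trans (by omega)) hZ.or_depth
    fun π hπ => .unmerging _ _ _ Y Z (Y ++ Z) (isDisjOf_disj _) (isDisjOf_disj _)
      (isDisjOf_disj _) (by simp) hπ
  exact ⟨hZ, k2.unary (hZ.size_le.trans (by omega)) (hZ.depth_le.trans (by omega))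
    fun π hπ => .merging _ _ _ [disj Y] Z (disj Y :: Z) (isDisjOf_singleton _) (isDisjOf_disj _)
      (isDisjOf_disj _) (by simp) hπ⟩

/-- A bare line `F` is not literally `disj [F]`; weakening by FALSE and merging turns it into a
clause. -/
theorem ClauseDerives.hypothesis (hF : F ∈ H) (h : Small l s d [F]) :
    ClauseDerives q H l s d 3 [F] := by
  have hs := h.size_le
  rw [size_disj] at hs
  simp only [List.map_cons, List.map_nil, List.sum_cons, List.sum_nil] at hs
  have hd := (h.2 F (by simp)).2
  have h1 := Derives.axiomatic (q := q) (H := H) (K := F) (B := 3 * (l * s) + 5)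
    (D := d + 2) (by omega) (by omega) fun π => .hypothesis F hF
  have h2 := h1.unary (K := or F (disj [])) (h.or_size.trans (by omega)) h.or_depth
    fun π hπ => .weakening _ _ hπ
  exact ⟨h, h2.unary (h.size_le.trans (by omega)) (h.depth_le.trans (by omega))
    fun π hπ => .merging _ _ _ [F] [] [F] (isDisjOf_singleton _) (isDisjOf_disj _)
      (isDisjOf_disj _) (by simp) hπ⟩

/-- Cutting away all the negated members of a clause. -/
theorem ClauseDerives.cutAll (C : List (PropFormula α))
    (h : ClauseDerives q H l s d L₁ (C.map neg ++ Y))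
    (hC : ∀ c ∈ C, ClauseDerives q H l s d L₂ (c :: Y)) :
    ClauseDerives q H l s d (L₁ + C.length * (L₂ + 6)) Y := by
  induction C generalizing L₁ with
  | nil => simpa using h
  | cons c C ih =>
    have h1 := (hC c (by simp)).cut h (Z := C.map neg ++ Y) (by simp) (by simp) h.1.tail
    refine (ih h1 fun c' hc' => hC c' (by simp [hc'])).mono ?_
    simp only [List.length_cons]
    ring_nf
    omega

end CountingFrege

/-! ### Partial assignments: contradictions, decision trees and DNFs -/

namespace LinearSystem

open PropFormula CountingFrege

variable {n q : ℕ}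

/-- The literal on `x_j` that is false under the assignment with set `S` of true variables. -/
def falseLiteral (S : Finset (Fin n)) (j : Fin n) : PropFormula (Fin n) :=
  if j ∈ S then neg (var j) else var j

theorem excludingClause_eq (T S : Finset (Fin n)) :
    excludingClause T S = disj (T.toList.map (falseLiteral S)) := rfl

theorem falseLiteral_bound (S : Finset (Fin n)) (j : Fin n) :
    (falseLiteral S j).size ≤ 2 ∧ (falseLiteral S j).depth ≤ 1 := by
  unfold falseLiteral
  split <;> simp [size, depth]

theorem size_excludingClause_le (T S : Finset (Fin n)) :
    (excludingClause T S).size ≤ 2 * n + 1 := by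
  rw [excludingClause_eq, mul_comm]
  refine size_disj_le (by simpa using T.card_le_univ) fun F hF => ?_
  obtain ⟨j, -, rfl⟩ := List.mem_map.1 hF
  exact (falseLiteral_bound S j).1

theorem depth_excludingClause_le (T S : Finset (Fin n)) : (excludingClause T S).depth ≤ 2 := by
  rw [excludingClause_eq]
  refine depth_disj_le fun F hF => ?_
  obtain ⟨j, -, rfl⟩ := List.mem_map.1 hF
  exact (falseLiteral_bound S j).2

/-- The clauses excluding the partial assignments in the list `t`, which are given by a domain and
a set of true variables. -/
noncomputable def excludingClauses (t : List (Finset (Fin n) × Finset (Fin n))) :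
    List (PropFormula (Fin n)) :=
  t.map fun p => excludingClause p.1 p.2

/-- The formula saying that some partial assignment in the list `t` holds. -/
noncomputable def someHolds (t : List (Finset (Fin n) × Finset (Fin n))) : PropFormula (Fin n) :=
  disj ((excludingClauses t).map neg)

theorem size_someHolds_le {t : List (Finset (Fin n) × Finset (Fin n))} {k : ℕ}
    (ht : t.length ≤ k) : (someHolds t).size ≤ k * (2 * n + 2) + 1 := by
  refine size_disj_le (by simpa [excludingClauses] using ht) fun F hF => ?_
  simp only [excludingClauses, List.map_map, List.mem_map, Function.comp] at hF
  obtain ⟨p, -, rfl⟩ := hF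
  rw [size_neg]
  have := size_excludingClause_le p.1 p.2
  omega

theorem depth_someHolds_le (t : List (Finset (Fin n) × Finset (Fin n))) :
    (someHolds t).depth ≤ 4 := by
  refine depth_disj_le fun F hF => ?_
  simp only [excludingClauses, List.map_map, List.mem_map, Function.comp] at hF
  obtain ⟨p, -, rfl⟩ := hF
  rw [depth_neg]
  have := depth_excludingClause_le p.1 p.2
  omega

/-- Two partial assignments contradict each other. -/
def Contradict (p r : Finset (Fin n) × Finset (Fin n)) : Prop :=
  ∃ j ∈ p.1, j ∈ r.1 ∧ (j ∈ p.2 ↔ j ∉ r.2)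

variable {H : Set (PropFormula (Fin n))} {l s d L : ℕ} {X Y : List (PropFormula (Fin n))}

theorem small_cons {F : PropFormula (Fin n)} {b : ℕ} (hs : F.size ≤ s) (hd : F.depth ≤ d)
    (hX : Small b s d X) (hb : b + 1 ≤ l) : Small l s d (F :: X) := by
  refine ⟨by have := hX.1; simp; omega, fun G hG => ?_⟩
  rcases List.mem_cons.1 hG with rfl | hG
  exacts [⟨hs, hd⟩, hX.2 G hG]

theorem small_append {a b : ℕ} (hX : Small a s d X) (hY : Small b s d Y) (hl : a + b ≤ l) :
    Small l s d (X ++ Y) := by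
  refine ⟨by have := hX.1; have := hY.1; simp; omega, fun G hG => ?_⟩
  rcases List.mem_append.1 hG with hG | hG
  exacts [hX.2 G hG, hY.2 G hG]

theorem small_nil : Small l s d ([] : List (PropFormula (Fin n))) :=
  ⟨by simp, by simp⟩

theorem small_map {β : Type*} {f : β → PropFormula (Fin n)} {t : List β} (ht : t.length ≤ l)
    (h : ∀ x, (f x).size ≤ s ∧ (f x).depth ≤ d) : Small l s d (t.map f) := by
  refine ⟨by simpa using ht, fun F hF => ?_⟩
  obtain ⟨x, -, rfl⟩ := List.mem_map.1 hF
  exact h x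

theorem small_literals (hs : 2 ≤ s) (hd : 1 ≤ d) (T S : Finset (Fin n)) :
    Small n s d (T.toList.map (falseLiteral S)) :=
  small_map (by simpa using T.card_le_univ)
    fun j => ⟨(falseLiteral_bound S j).1.trans hs, (falseLiteral_bound S j).2.trans hd⟩

/-- Contradictory partial assignments are not both true. -/
theorem clauseDerives_of_contradict {p r : Finset (Fin n) × Finset (Fin n)}
    (h : Contradict p r) (hl : 2 * n + 2 ≤ l) (hs : 2 * n + 2 ≤ s) (hd : 3 ≤ d) :
    ClauseDerives q H l s d 11 [excludingClause p.1 p.2, excludingClause r.1 r.2] := by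
  obtain ⟨j, hjp, hjr, hj⟩ := h
  have hn : 0 < n := j.pos
  set P := p.1.toList.map (falseLiteral p.2) with hP
  set R := r.1.toList.map (falseLiteral r.2) with hR
  have hPR : Small l s d (P ++ R) :=
    small_append (small_literals (by omega) (by omega) _ _)
      (small_literals (by omega) (by omega) _ _) (by omega)
  -- The two assignments disagree at `j`, so the union of their excluding clauses contains a
  -- variable and its negation.
  have h1 : ClauseDerives q H l s d 3 (P ++ R) := by
    have hp : falseLiteral p.2 j ∈ P := List.mem_map.2 ⟨j, by simpa using hjp, rfl⟩
    have hr : falseLiteral r.2 j ∈ R := List.mem_map.2 ⟨j, by simpa using hjr, rfl⟩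
    unfold falseLiteral at hp hr
    by_cases hjS : j ∈ p.2
    · rw [if_pos hjS] at hp
      rw [if_neg (hj.1 hjS)] at hr
      exact .excludedMiddle (A := var j) (by simp [hr]) (by simp [hp]) hPR
    · rw [if_neg hjS] at hp
      rw [if_pos (by tauto)] at hr
      exact .excludedMiddle (A := var j) (by simp [hp]) (by simp [hr]) hPR
  have bnd : ∀ T S : Finset (Fin n), (excludingClause T S).size ≤ s ∧
      (excludingClause T S).depth ≤ d := fun T S =>
    ⟨(size_excludingClause_le T S).trans (by omega), (depth_excludingClause_le T S).trans
      (by omega)⟩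
  have h2 : ClauseDerives q H l s d 7 (excludingClause r.1 r.2 :: P) :=
    h1.unflatten (Y := R) (by simp) (small_cons (bnd _ _).1 (bnd _ _).2
      (small_literals (by omega) (by omega) _ _) (by omega : n + 1 ≤ l))
  exact h2.unflatten (Y := P) (by simp) (small_cons (bnd _ _).1 (bnd _ _).2
    (small_cons (bnd _ _).1 (bnd _ _).2 (small_nil (l := 0)) (le_refl 1)) (by omega))

/-- Decision tree on a list of variables. -/
theorem clauseDerives_decisionTree (v : List (Fin n)) (hv : v.Nodup)
    (h : ∀ S : Finset (Fin n), ClauseDerives q H l s d L (v.map (falseLiteral S) ++ Y)) :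
    ClauseDerives q H l s d (2 ^ v.length * (L + 6)) Y := by
  induction v generalizing L with
  | nil => exact (h ∅).mono (by simp)
  | cons j v ih =>
    rw [List.nodup_cons] at hv
    have key : ∀ S : Finset (Fin n),
        ClauseDerives q H l s d (L + L + 6) (v.map (falseLiteral S) ++ Y) := by
      intro S
      -- The two branches at `j`: the clauses agree on all other variables of the list, so a single
      -- cut on `var j` removes the query.
      have h1 := h (S.erase j)
      have h2 := h (insert j S)
      have e1 : v.map (falseLiteral (S.erase j)) = v.map (falseLiteral S) :=
        List.map_congr_left fun k hk => by
          have : k ≠ j := fun e => hv.1 (e ▸ hk)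
          simp [falseLiteral, this]
      have e2 : v.map (falseLiteral (insert j S)) = v.map (falseLiteral S) :=
        List.map_congr_left fun k hk => by
          have : k ≠ j := fun e => hv.1 (e ▸ hk)
          simp [falseLiteral, this]
      have e3 : falseLiteral (S.erase j) j = var j := by simp [falseLiteral]
      have e4 : falseLiteral (insert j S) j = neg (var j) := by simp [falseLiteral]
      rw [List.map_cons, List.cons_append, e1, e3] at h1
      rw [List.map_cons, List.cons_append, e2, e4] at h2
      exact h1.cut h2 (by simp) (by simp) h1.1.tail
    -- Each query replaces L by 2L + 6, that is, doubles L + 6.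
    refine (ih hv.2 key).mono (le_of_eq ?_)
    rw [List.length_cons, pow_succ]
    ring

/-- Every member of a conjunction that is a hypothesis can be derived. -/
theorem clauseDerives_of_conj_mem {Cs : List (PropFormula (Fin n))} (hH : conj Cs ∈ H)
    {C : PropFormula (Fin n)} (hC : C ∈ Cs) (hl : Cs.length + 2 ≤ l)
    (hs : (conj Cs).size ≤ s) (hd : ∀ F ∈ Cs, F.depth + 3 ≤ d)
    (hsz : ∀ F ∈ Cs, F.size + 1 ≤ s) : ClauseDerives q H l s d 16 [C] := by
  set N := Cs.map neg with hN
  have hs' : (disj N).size + 1 ≤ s := by rwa [conj, size_neg] at hs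
  have hd1 : (disj N).depth + 1 ≤ d := by
    have : (disj N).depth ≤ d - 2 + 1 := depth_disj_le fun F hF => by
      obtain ⟨G, hG, rfl⟩ := List.mem_map.1 hF
      rw [depth_neg]
      have := hd G hG
      omega
    have := hd C hC
    omega
  have hCs := hsz C hC
  have hCd := hd C hC
  have h1 : ClauseDerives q H l s d 3 [neg (disj N)] := .hypothesis hH
    (small_cons (b := 0) hs (by rwa [depth_neg]) small_nil (by omega))
  have hNs : Small Cs.length s d N := by
    refine ⟨by simp [hN], fun F hF => ?_⟩
    obtain ⟨G, hG, rfl⟩ := List.mem_map.1 hF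
    rw [depth_neg, size_neg]
    have := hd G hG
    exact ⟨hsz G hG, by omega⟩
  -- The conjunction is the negation of `disj N`, and `neg C` is a member of `N`. So excluded middle
  -- for `C` gives "C or `disj N`", which is then cut against the hypothesis.
  have h2 : ClauseDerives q H l s d 3 (C :: N) :=
    .excludedMiddle (A := C) (by simp) (by simp [hN, hC])
      (small_cons (by omega) (by omega) hNs (by omega))
  have hsm : Small l s d [C] := small_cons (b := 0) (by omega) (by omega) small_nil (by omega)
  have h3 : ClauseDerives q H l s d 7 [disj N, C] := h2.unflatten (Y := N)
    (by simp) (small_cons (by omega) (by omega) (b := 1)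
      (small_cons (b := 0) (by omega) (by omega) small_nil (by omega)) (by omega))
  exact h3.cut h1 (by simp) (by simp) hsm

/-- A partial assignment in `t` implies the double negation of the formula `someHolds t`. -/
theorem clauseDerives_someHolds_of_mem {t : List (Finset (Fin n) × Finset (Fin n))}
    {p : Finset (Fin n) × Finset (Fin n)} (hp : p ∈ t) {k : ℕ} (ht : t.length ≤ k)
    (hl : k + n + 4 ≤ l) (hs : k * (2 * n + 2) + 3 ≤ s) (hd : 6 ≤ d) :
    ClauseDerives q H l s d 20
      (p.1.toList.map (falseLiteral p.2) ++ [neg (neg (someHolds t))]) := by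
  have hk : 2 * n + 2 ≤ k * (2 * n + 2) :=
    Nat.le_mul_of_pos_left _ ((List.length_pos_of_mem hp).trans_le ht)
  have hσ := size_someHolds_le ht
  have hσ' := depth_someHolds_le t
  have bc : ∀ p : Finset (Fin n) × Finset (Fin n), (excludingClause p.1 p.2).size + 1 ≤ s ∧
      (excludingClause p.1 p.2).depth + 1 ≤ d := fun p => by
    have := size_excludingClause_le p.1 p.2
    have := depth_excludingClause_le p.1 p.2
    omega
  have s1 : (neg (someHolds t)).size ≤ s := by rw [size_neg]; omega
  have s2 : (neg (neg (someHolds t))).size ≤ s := by rw [size_neg, size_neg]; omega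
  have d1 : (neg (someHolds t)).depth ≤ d := by rw [depth_neg]; omega
  have d2 : (neg (neg (someHolds t))).depth ≤ d := by rw [depth_neg, depth_neg]; omega
  have hN : Small k s d ((excludingClauses t).map neg) := by
    rw [excludingClauses, List.map_map]
    refine small_map ht fun p => ?_
    rw [Function.comp, size_neg, depth_neg]
    exact bc p
  have h1 : ClauseDerives q H l s d 3
      (excludingClause p.1 p.2 :: (excludingClauses t).map neg) :=
    .excludedMiddle (A := excludingClause p.1 p.2) (by simp)
      (List.mem_cons_of_mem _ (List.mem_map.2 ⟨_, List.mem_map.2 ⟨p, hp, rfl⟩, rfl⟩))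
      (small_cons (by have := bc p; omega) (by have := bc p; omega) hN (by omega))
  have h2 : ClauseDerives q H l s d 7 [someHolds t, excludingClause p.1 p.2] :=
    h1.unflatten (Y := (excludingClauses t).map neg) (by simp)
      (small_cons (b := 1) (by rw [← someHolds]; omega) (by rw [← someHolds]; omega)
        (small_cons (b := 0) (by have := bc p; omega) (by have := bc p; omega) small_nil
          (by omega)) (by omega))
  -- The double negation matches the counting formula, where a conjunction of negated variables
  -- unfolds to a negated disjunction of doubly negated ones.
  have h3 : ClauseDerives q H l s d 3 [neg (someHolds t), neg (neg (someHolds t))] :=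
    .excludedMiddle (A := neg (someHolds t)) (by simp) (by simp)
      (small_cons (b := 1) s1 d1 (small_cons (b := 0) s2 d2 small_nil (by omega)) (by omega))
  have h4 : ClauseDerives q H l s d 16 [excludingClause p.1 p.2, neg (neg (someHolds t))] :=
    h2.cut h3 (by simp) (by simp)
      (small_cons (b := 1) (by have := bc p; omega) (by have := bc p; omega)
        (small_cons (b := 0) s2 d2 small_nil (by omega)) (by omega))
  exact h4.flatten (Y := p.1.toList.map (falseLiteral p.2)) (by simp) (by simp)
    (small_append (b := 1) (small_literals (by omega) (by omega) _ _)
      (small_cons (b := 0) s2 d2 small_nil (by omega)) (by omega))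

/-- If all partial assignments in `t` contradict all those in `u`, then not both `someHolds t` and
`someHolds u`. -/
theorem clauseDerives_not_both {t u : List (Finset (Fin n) × Finset (Fin n))}
    (htu : ∀ p ∈ t, ∀ r ∈ u, Contradict p r) {k : ℕ} (ht : t.length ≤ k) (hu : u.length ≤ k)
    (hl : k + 2 * n + 4 ≤ l) (hs : k * (2 * n + 2) + 2 * n + 4 ≤ s) (hd : 6 ≤ d) :
    ClauseDerives q H l s d (7 + k * (34 * (k + 1))) [neg (someHolds t), neg (someHolds u)] := by
  have bc : ∀ p : Finset (Fin n) × Finset (Fin n), (excludingClause p.1 p.2).size + 1 ≤ s ∧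
      (excludingClause p.1 p.2).depth + 1 ≤ d := fun p => by
    have := size_excludingClause_le p.1 p.2
    have := depth_excludingClause_le p.1 p.2
    omega
  have bσ : ∀ t : List (Finset (Fin n) × Finset (Fin n)), t.length ≤ k →
      ((someHolds t).size + 1 ≤ s ∧ (neg (someHolds t)).size ≤ s) ∧
      ((someHolds t).depth + 1 ≤ d ∧ (neg (someHolds t)).depth ≤ d) := fun t ht => by
    have := size_someHolds_le ht
    have := depth_someHolds_le t
    rw [size_neg, depth_neg]
    omega
  have hN : ∀ t : List (Finset (Fin n) × Finset (Fin n)), t.length ≤ k →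
      Small k s d ((excludingClauses t).map neg) := fun t ht => by
    rw [excludingClauses, List.map_map]
    refine small_map ht fun p => ?_
    rw [Function.comp, size_neg, depth_neg]
    exact bc p
  -- Excluded middle for the DNF with its positive copy opened into terms: a clause of the shape
  -- that `cutAll` consumes.
  have start : ∀ t : List (Finset (Fin n) × Finset (Fin n)), t.length ≤ k →
      ∀ X, Small 2 s d X → neg (someHolds t) ∈ X →
      ClauseDerives q H l s d 7 ((excludingClauses t).map neg ++ X) := fun t ht X hX htX => by
    have h0 : ClauseDerives q H l s d 3 [someHolds t, neg (someHolds t)] :=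
      .excludedMiddle (A := someHolds t) (by simp) (by simp)
        (small_cons (b := 1) (by have := bσ t ht; omega) (by have := bσ t ht; omega)
          (small_cons (b := 0) (bσ t ht).1.2 (bσ t ht).2.2 small_nil (by omega)) (by omega))
    exact h0.flatten (by simp [htX]) (by simp) (small_append (hN t ht) hX (by omega))
  have s1 : ∀ X : List (PropFormula (Fin n)), ∀ t, t.length ≤ k → ∀ b, Small b s d X →
      Small (b + 1) s d (neg (someHolds t) :: X) := fun X t ht b hX =>
    small_cons (bσ t ht).1.2 (bσ t ht).2.2 hX le_rfl
  have s2 : ∀ X : List (PropFormula (Fin n)), ∀ p : Finset (Fin n) × Finset (Fin n),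
      ∀ b, Small b s d X → Small (b + 1) s d (excludingClause p.1 p.2 :: X) := fun X p b hX =>
    small_cons (by have := bc p; omega) (by have := bc p; omega) hX le_rfl
  have lift : ∀ {X : List (PropFormula (Fin n))} {b : ℕ}, Small b s d X → b ≤ l →
      Small l s d X := fun h hb => ⟨h.1.trans hb, h.2⟩
  -- For a fixed term `p` of `t`, every term of `u` is cut away by its contradiction with `p`; the
  -- terms of `t` are then cut away using these clauses.
  have inner : ∀ p ∈ t, ClauseDerives q H l s d (7 + k * 19)
      [neg (someHolds u), excludingClause p.1 p.2] := fun p hp => by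
    have h1 := ClauseDerives.cutAll (L₂ := 13) (excludingClauses u)
      (start u hu [neg (someHolds u), excludingClause p.1 p.2]
        (s1 _ u hu 1 (s2 _ p 0 small_nil)) (by simp)) (fun c hc => by
        obtain ⟨r, hr, rfl⟩ := List.mem_map.1 hc
        exact (clauseDerives_of_contradict (htu p hp r hr) (by omega) (by omega)
          (by omega)).weaken (by simp) (lift (s2 _ r 2 (s1 _ u hu 1 (s2 _ p 0 small_nil)))
            (by omega)))
    refine h1.mono ?_
    have : (excludingClauses u).length ≤ k := by simpa [excludingClauses] using hu
    have := Nat.mul_le_mul_right 19 this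
    omega
  have h1 := ClauseDerives.cutAll (L₂ := 9 + k * 19) (excludingClauses t)
    (start t ht [neg (someHolds t), neg (someHolds u)]
      (s1 _ t ht 1 (s1 _ u hu 0 small_nil)) (by simp)) (fun c hc => by
      obtain ⟨p, hp, rfl⟩ := List.mem_map.1 hc
      exact ((inner p hp).weaken (by simp)
        (lift (s2 _ p 2 (s1 _ t ht 1 (s1 _ u hu 0 small_nil))) (by omega))).mono (by omega))
  refine h1.mono ?_
  have : (excludingClauses t).length ≤ k := by simpa [excludingClauses] using ht
  have := Nat.mul_le_mul this (by omega : 9 + k * 19 + 6 ≤ 34 * (k + 1))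
  omega

end LinearSystem

/-! ### Substitution instances of the counting formula -/

namespace CountingFrege

open PropFormula

open Classical in
/-- The `q`-element sets of points through `v`. -/
noncomputable def star (q : ℕ) {N : ℕ} (v : Fin N) : List (Finset (Fin N)) :=
  ((Finset.powersetCard q (Finset.univ : Finset (Fin N))).filter fun e => v ∈ e).toList

open Classical in
/-- The pairs of conflicting `q`-element sets of points. -/
noncomputable def conflicts (q N : ℕ) : List (Finset (Fin N) × Finset (Fin N)) :=
  ((Finset.powersetCard q (Finset.univ : Finset (Fin N)) ×ˢ
    Finset.powersetCard q (Finset.univ : Finset (Fin N))).filter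
      fun p => Conflict p.1 p.2).toList

theorem mem_star {q N : ℕ} {v : Fin N} {e : Finset (Fin N)} :
    e ∈ star q v ↔ e.card = q ∧ v ∈ e := by
  simp [star]

theorem mem_conflicts {q N : ℕ} {p : Finset (Fin N) × Finset (Fin N)} (h : p ∈ conflicts q N) :
    Conflict p.1 p.2 := by
  simp only [conflicts, Finset.mem_toList, Finset.mem_filter] at h
  exact h.2

theorem length_star_le (q : ℕ) {N : ℕ} (v : Fin N) : (star q v).length ≤ N ^ q := by
  rw [star, Finset.length_toList]
  refine (Finset.card_filter_le _ _).trans ?_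
  rw [Finset.card_powersetCard, Finset.card_univ, Fintype.card_fin]
  exact Nat.choose_le_pow _ _

theorem length_conflicts_le (q N : ℕ) : (conflicts q N).length ≤ N ^ q * N ^ q := by
  classical
  rw [conflicts, Finset.length_toList]
  refine (Finset.card_filter_le _ _).trans ?_
  rw [Finset.card_product, Finset.card_powersetCard, Finset.card_univ, Fintype.card_fin]
  exact Nat.mul_le_mul (Nat.choose_le_pow _ _) (Nat.choose_le_pow _ _)

/-- The formula saying that `v` lies in some chosen set. -/
noncomputable def covered {α : Type} (q : ℕ) {N : ℕ} (σ : Finset (Fin N) → PropFormula α)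
    (v : Fin N) : PropFormula α :=
  disj ((star q v).map fun e => neg (neg (σ e)))

/-- The formula saying that not both sets of the pair `p` are chosen. -/
def notBoth {α : Type} {N : ℕ} (σ : Finset (Fin N) → PropFormula α)
    (p : Finset (Fin N) × Finset (Fin N)) : PropFormula α :=
  disj [neg (σ p.1), neg (σ p.2)]

/-- As conjunctions are negated disjunctions, an instance is a disjunction of negations only. It is
therefore refuted by deriving each `covered` and each `notBoth` formula. -/
theorem subst_countFormula {α : Type} (q N : ℕ) (σ : Finset (Fin N) → PropFormula α) :
    (countFormula q N).subst σ =
      or (disj (((Finset.univ : Finset (Fin N)).toList.map (covered q σ)).map neg))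
        (disj (((conflicts q N).map (notBoth σ)).map neg)) := by
  simp only [countFormula, PropFormula.or, PropFormula.conj, subst, List.map_cons, List.map_nil,
    List.map_map, covered, notBoth, star, conflicts, Function.comp_def]

end CountingFrege

/-! ### From families of partial assignments to a refutation -/

namespace LinearSystem

open PropFormula CountingFrege

variable {n q : ℕ} {H : Set (PropFormula (Fin n))} {l s d L : ℕ}

theorem size_covered_le {N : ℕ} {t : Finset (Fin N) → List (Finset (Fin n) × Finset (Fin n))}
    {k : ℕ} (hk : ∀ e, (t e).length ≤ k) (v : Fin N) :
    (covered q (fun e => someHolds (t e)) v).size ≤ N ^ q * (k * (2 * n + 2) + 3) + 1 := by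
  refine size_disj_le (by simpa using length_star_le q v) fun F hF => ?_
  obtain ⟨e, -, rfl⟩ := List.mem_map.1 hF
  dsimp only
  rw [size_neg, size_neg]
  have := size_someHolds_le (hk e)
  omega

theorem depth_covered_le {N : ℕ} (t : Finset (Fin N) → List (Finset (Fin n) × Finset (Fin n)))
    (v : Fin N) : (covered q (fun e => someHolds (t e)) v).depth ≤ 7 := by
  refine depth_disj_le fun F hF => ?_
  obtain ⟨e, -, rfl⟩ := List.mem_map.1 hF
  dsimp only
  rw [depth_neg, depth_neg]
  have := depth_someHolds_le (t e)
  omega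

theorem size_notBoth_le {N : ℕ} {t : Finset (Fin N) → List (Finset (Fin n) × Finset (Fin n))}
    {k : ℕ} (hk : ∀ e, (t e).length ≤ k) (p : Finset (Fin N) × Finset (Fin N)) :
    (notBoth (fun e => someHolds (t e)) p).size ≤ 2 * (k * (2 * n + 2) + 2) + 1 := by
  refine size_disj_le (by simp) fun F hF => ?_
  have h1 := size_someHolds_le (hk p.1)
  have h2 := size_someHolds_le (hk p.2)
  simp only [List.mem_cons, List.not_mem_nil, or_false] at hF
  rcases hF with rfl | rfl <;> rw [size_neg] <;> omega

theorem depth_notBoth_le {N : ℕ} (t : Finset (Fin N) → List (Finset (Fin n) × Finset (Fin n)))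
    (p : Finset (Fin N) × Finset (Fin N)) :
    (notBoth (fun e => someHolds (t e)) p).depth ≤ 6 := by
  refine depth_disj_le fun F hF => ?_
  have h1 := depth_someHolds_le (t p.1)
  have h2 := depth_someHolds_le (t p.2)
  simp only [List.mem_cons, List.not_mem_nil, or_false] at hF
  rcases hF with rfl | rfl <;> rw [depth_neg] <;> omega

/-- Families of partial assignments attached to the sets of points that provably form a partition
refute the hypotheses, if the number of points is not divisible by `q`. -/
theorem clauseDerives_refute {N : ℕ} (hN : ¬ q ∣ N)
    (t : Finset (Fin N) → List (Finset (Fin n) × Finset (Fin n))) {k : ℕ}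
    (hk : ∀ e, (t e).length ≤ k)
    (hconf : ∀ e f, Conflict e f → ∀ p ∈ t e, ∀ r ∈ t f, Contradict p r)
    (hcov : ∀ v, ClauseDerives q H l s d L
      ((star q v).map fun e => neg (neg (someHolds (t e)))))
    (hl : N + N ^ q * N ^ q + k + 2 * n + 4 ≤ l)
    (hs : N ^ q * (k * (2 * n + 2) + 3) + 2 * (k * (2 * n + 2)) + 2 * n + 10 ≤ s)
    (hd : 8 ≤ d) :
    ClauseDerives q H l s d
      (4 + (N + N ^ q * N ^ q) * (L + 7 + k * (34 * (k + 1)) + 10)) [] := by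
  set σ : Finset (Fin N) → PropFormula (Fin n) := fun e => someHolds (t e) with hσ
  set V := (Finset.univ : Finset (Fin N)).toList.map (covered q σ) with hV
  set P := (conflicts q N).map (notBoth σ) with hP
  have bV : ∀ v, (covered q σ v).size + 1 ≤ s ∧ (covered q σ v).depth + 1 ≤ d := fun v => by
    have : (covered q σ v).size ≤ _ := size_covered_le hk v
    have : (covered q σ v).depth ≤ _ := depth_covered_le t v
    omega
  have bP : ∀ p, (notBoth σ p).size + 1 ≤ s ∧ (notBoth σ p).depth + 1 ≤ d := fun p => by
    have : (notBoth σ p).size ≤ _ := size_notBoth_le hk p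
    have : (notBoth σ p).depth ≤ _ := depth_notBoth_le t p
    omega
  have hVP : (V ++ P).length ≤ N + N ^ q * N ^ q := by
    have := length_conflicts_le q N
    simp only [hV, hP, List.length_append, List.length_map, Finset.length_toList,
      Finset.card_univ, Fintype.card_fin]
    omega
  have small : Small (N + N ^ q * N ^ q) s d ((V ++ P).map neg) := by
    refine ⟨by simpa using hVP, fun F hF => ?_⟩
    obtain ⟨G, hG, rfl⟩ := List.mem_map.1 hF
    rw [size_neg, depth_neg]
    rcases List.mem_append.1 hG with hG | hG <;> obtain ⟨x, -, rfl⟩ := List.mem_map.1 hG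
    exacts [bV x, bP x]
  have hsz : (disj (V.map neg)).size + (disj (P.map neg)).size ≤ l * s + 2 := by
    have h1 := small.size_le
    have h2 := size_disj_append (V.map neg) (P.map neg)
    rw [← List.map_append] at h2
    have h3 : (N + N ^ q * N ^ q) * s ≤ l * s := Nat.mul_le_mul_right _ (by omega)
    omega
  have hdp : (disj (V.map neg)).depth ≤ d + 1 ∧ (disj (P.map neg)).depth ≤ d + 1 :=
    ⟨depth_disj_le fun F hF => (small.2 F (by
        rw [List.map_append]; exact List.mem_append_left _ hF)).2,
      depth_disj_le fun F hF => (small.2 F (by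
        rw [List.map_append]; exact List.mem_append_right _ hF)).2⟩
  have hd0 : Derives q H (3 * (l * s) + 5) (d + 2) 1
      (or (disj (V.map neg)) (disj (P.map neg))) := by
    refine Derives.axiomatic (by rw [size_or]; omega) (depth_or_le hdp.1 hdp.2) fun π => ?_
    rw [hV, hP, ← subst_countFormula]
    exact .counting N hN σ
  have small' : Small l s d ((V ++ P).map neg ++ []) := by
    rw [List.append_nil]
    exact ⟨small.1.trans (by omega), small.2⟩
  -- The two halves of the counting instance become one clause of negations, in the form required by
  -- `cutAll` with empty remainder.
  have h1 : ClauseDerives q H l s d 4 ((V ++ P).map neg ++ []) :=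
    ⟨small', hd0.merge_weaken (by omega)
      (fun F hF => (small.2 F (by rwa [List.map_append])).2) (by simp) (by simp) small'⟩
  refine (h1.cutAll (L₂ := L + 4 + 7 + k * (34 * (k + 1))) (V ++ P) ?_).mono ?_
  · intro C hC
    rcases List.mem_append.1 hC with hC | hC <;> obtain ⟨x, hx, rfl⟩ := List.mem_map.1 hC
    · refine ((hcov x).unflatten (Z := []) (fun F hF => List.mem_append_left _ hF)
        (small_cons (b := 0) ?_ ?_ small_nil
        (by omega))).mono (by omega)
      · exact (Nat.le_succ _).trans (bV x).1
      · exact (Nat.le_succ _).trans (bV x).2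
    · refine ((clauseDerives_not_both (hconf x.1 x.2 (mem_conflicts hx)) (hk _) (hk _)
        (by omega) (by omega) (by omega)).unflatten
        (Z := []) (fun F hF => List.mem_append_left _ hF)
        (small_cons (b := 0) ?_ ?_ small_nil (by omega))).mono (by omega)
      · exact (Nat.le_succ _).trans (bP x).1
      · exact (Nat.le_succ _).trans (bP x).2
  · have := Nat.mul_le_mul_right (L + 4 + 7 + k * (34 * (k + 1)) + 6) hVP
    refine Nat.add_le_add_left (this.trans (Nat.mul_le_mul_left _ (by omega))) _

/-- A point is covered if, for every assignment to the variables of `T`, a hypothesis fails or one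
of the sets through this point is chosen. -/
theorem clauseDerives_cover {N : ℕ} (v : Fin N)
    (t : Finset (Fin N) → List (Finset (Fin n) × Finset (Fin n))) {k : ℕ}
    (hk : ∀ e, (t e).length ≤ k) (T : Finset (Fin n)) (hL : 20 ≤ L)
    (h : ∀ S, S ⊆ T → ClauseDerives q H l s d L [excludingClause T S] ∨
      ∃ e ∈ star q v, ∃ p ∈ t e, p.1 ⊆ T ∧ ∀ j ∈ p.1, (j ∈ p.2 ↔ j ∈ S))
    (hl : N ^ q + k + n + 4 ≤ l) (hs : k * (2 * n + 2) + 3 ≤ s) (hd : 6 ≤ d) :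
    ClauseDerives q H l s d (2 ^ T.card * (L + 10))
      ((star q v).map fun e => neg (neg (someHolds (t e)))) := by
  set Y := (star q v).map fun e => neg (neg (someHolds (t e))) with hY
  have sY : Small (N ^ q) s d Y := small_map (length_star_le q v) fun e => by
    rw [size_neg, size_neg, depth_neg, depth_neg]
    have := size_someHolds_le (hk e)
    have := depth_someHolds_le (t e)
    omega
  have key : ∀ S : Finset (Fin n),
      ClauseDerives q H l s d (L + 4) (T.toList.map (falseLiteral S) ++ Y) := by
    intro S
    -- The decision tree ranges over all sets `S`, but only the part inside `T` is visible to the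
    -- literals.
    have hST : T.toList.map (falseLiteral S) = T.toList.map (falseLiteral (S ∩ T)) :=
      List.map_congr_left fun j hj => by
        have : j ∈ T := by simpa using hj
        simp [falseLiteral, this]
    have hsm : ∀ S, Small l s d (T.toList.map (falseLiteral S) ++ Y) := by
      intro S
      by_cases hn : 2 ≤ s
      · exact small_append (small_literals hn (by omega) _ _) sY (by omega)
      · omega
    rw [hST]
    rcases h (S ∩ T) Finset.inter_subset_right with h | ⟨e, he, p, hp, hpT, hpS⟩
    · exact h.flatten (Y := T.toList.map (falseLiteral (S ∩ T))) (by simp) (by simp) (hsm _)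
    · refine ((clauseDerives_someHolds_of_mem hp (hk e) (by omega) hs hd).weaken
        (fun F hF => ?_) (hsm _)).mono (by omega)
      -- The assignment `p` is a restriction of the branch, so its literals already occur among
      -- those on `T`.
      rcases List.mem_append.1 hF with hF | hF
      · obtain ⟨j, hj, rfl⟩ := List.mem_map.1 hF
        rw [Finset.mem_toList] at hj
        refine List.mem_append_left _ (List.mem_map.2 ⟨j, by simpa using hpT hj, ?_⟩)
        simp only [falseLiteral, hpS j hj]
      · rw [List.mem_singleton] at hF
        exact List.mem_append_right _ (List.mem_map.2 ⟨e, he, hF.symm⟩)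
  have := clauseDerives_decisionTree T.toList T.nodup_toList key
  rwa [Finset.length_toList, add_assoc] at this

end LinearSystem

/-! ### The combinatorial reduction to counting modulo q -/

namespace LinearSystem

open CountingFrege

/-- Blocks of `q` elements are removed one at a time, by induction on the quotient of the
cardinality by `q`. -/
theorem exists_partition_blocks {V : Type} [DecidableEq V] {q : ℕ} (Q : Finset V)
    (hQ : q ∣ Q.card) :
    ∃ B : Finset (Finset V), (∀ v ∈ Q, ∃ e ∈ B, v ∈ e) ∧ (∀ e ∈ B, e.card = q ∧ e ⊆ Q) ∧
      ∀ e ∈ B, ∀ f ∈ B, ¬ Conflict e f := by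
  obtain ⟨k, hk⟩ := hQ
  induction k generalizing Q with
  | zero => exact ⟨∅, by simp_all⟩
  | succ k ih =>
    obtain ⟨e, heQ, he⟩ := Finset.exists_subset_card_eq (s := Q) (n := q)
      (by rw [hk]; exact Nat.le_mul_of_pos_right _ k.succ_pos)
    obtain ⟨B, h1, h2, h3⟩ := ih (Q \ e) (by
      rw [Finset.card_sdiff_of_subset heQ, hk, he, Nat.mul_succ, Nat.add_sub_cancel])
    have hdis : ∀ f ∈ B, Disjoint e f := fun f hf =>
      Finset.disjoint_left.2 fun v hv hv' => (Finset.mem_sdiff.1 ((h2 f hf).2 hv')).2 hv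
    refine ⟨insert e B, fun v hv => ?_, fun f hf => ?_, fun f hf g hg hfg => ?_⟩
    · by_cases hve : v ∈ e
      · exact ⟨e, by simp, hve⟩
      · obtain ⟨f, hf, hvf⟩ := h1 v (by simp [hv, hve])
        exact ⟨f, by simp [hf], hvf⟩
    · rcases Finset.mem_insert.1 hf with rfl | hf
      exacts [⟨he, heQ⟩, ⟨(h2 f hf).1, (h2 f hf).2.trans Finset.sdiff_subset⟩]
    · rcases Finset.mem_insert.1 hf with rfl | hfB <;>
        rcases Finset.mem_insert.1 hg with rfl | hgB
      · exact hfg.1 rfl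
      · exact hfg.2 (hdis g hgB)
      · exact hfg.2 (hdis f hfB).symm
      · exact h3 f hfB g hgB hfg

/-- There is a finite set of points with prescribed fibre cardinalities over `κ`. -/
theorem exists_fibration {κ : Type} [Fintype κ] [DecidableEq κ] (a : κ → ℕ) :
    ∃ (N : ℕ) (loc : Fin N → κ), N = ∑ p, a p ∧ (∀ v, a (loc v) ≠ 0) ∧
      ∀ D : Finset κ, (Finset.univ.filter fun v => loc v ∈ D).card = ∑ p ∈ D, a p := by
  let φ := Fintype.equivFin (Σ p : κ, Fin (a p))
  refine ⟨_, fun v => (φ.symm v).1, by simp, fun v h => ?_, fun D => ?_⟩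
  · exact ((φ.symm v).2.cast h).elim0
  · rw [← Finset.card_map φ.symm.toEmbedding]
    have : (Finset.univ.filter fun v => (φ.symm v).1 ∈ D).map φ.symm.toEmbedding =
        D.sigma fun _ => Finset.univ := by
      ext x
      simp only [Finset.mem_map_equiv, Finset.mem_filter, Finset.mem_univ, true_and,
        Finset.mem_sigma, and_true, Equiv.symm_symm, Equiv.symm_apply_apply]
    rw [this, Finset.card_sigma]
    simp

variable {q m n : ℕ}

/-- An unsolvable linear system has a combination of its rows that reads `0 = c` with `c ≠ 0`. -/
theorem exists_row_combination [Fact q.Prime] (A : Matrix (Fin m) (Fin n) (ZMod q))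
    (b : Fin m → ZMod q) (h : ¬ ∃ x : Fin n → ZMod q, A.mulVec x = b) :
    ∃ y : Fin m → ZMod q, (∀ j, ∑ i, y i * A i j = 0) ∧ ∑ i, y i * b i ≠ 0 := by
  have hb : b ∉ LinearMap.range A.mulVecLin := by
    rintro ⟨x, hx⟩
    exact h ⟨x, hx⟩
  -- A linear functional separates `b` from the column space; its coordinates are the row
  -- multipliers.
  obtain ⟨f, hf, hf'⟩ := Submodule.exists_le_ker_of_notMem hb
  have hfv : ∀ z : Fin m → ZMod q, f z = ∑ i, f (Pi.single i 1) * z i := fun z => by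
    rw [LinearMap.pi_apply_eq_sum_univ f z]
    refine Finset.sum_congr rfl fun i _ => ?_
    rw [smul_eq_mul, mul_comm]
    congr 2
    ext k
    simp [Pi.single_apply, eq_comm]
  refine ⟨fun i => f (Pi.single i 1), fun j => ?_, by rwa [hfv] at hf⟩
  have : f (A.mulVec (Pi.single j 1)) = 0 := hf' ⟨_, rfl⟩
  rw [hfv] at this
  simpa using this

theorem mem_rowSupport {A : Matrix (Fin m) (Fin n) (ZMod q)} {i : Fin m} {j : Fin n} :
    j ∈ rowSupport A i ↔ A i j ≠ 0 := by
  simp [rowSupport]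

open Classical in
/-- The reduction of an unsolvable linear system modulo `q` to the counting principle. -/
theorem exists_partial_assignments [Fact q.Prime] (A : Matrix (Fin m) (Fin n) (ZMod q))
    (b : Fin m → ZMod q) (h : ¬ ∃ x : Fin n → ZMod q, A.mulVec x = b) :
    ∃ (N : ℕ) (t : Finset (Fin N) → List (Finset (Fin n) × Finset (Fin n))),
      ¬ q ∣ N ∧ N ≤ m * (n + 1) * q ∧ (∀ e, (t e).length ≤ n + m * 2 ^ width A) ∧
      (∀ e f, Conflict e f → ∀ p ∈ t e, ∀ r ∈ t f, Contradict p r) ∧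
      ∀ v, ∃ i, ∀ S, S ⊆ rowSupport A i → ∑ j ∈ S, A i j ≠ b i ∨
        ∃ e ∈ star q v, ∃ p ∈ t e, p.1 ⊆ rowSupport A i ∧ ∀ j ∈ p.1, (j ∈ p.2 ↔ j ∈ S) := by
  obtain ⟨y, hy, hyb⟩ := exists_row_combination A b h
  have hq : 0 < q := (Fact.out : q.Prime).pos
  have : NeZero q := ⟨hq.ne'⟩
  -- The index `none` is the extra position of a row, for its right-hand side.
  let a : Fin m × Option (Fin n) → ZMod q := fun p => p.2.elim (-(y p.1 * b p.1))
    fun j => y p.1 * A p.1 j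
  obtain ⟨N, loc, hN, hloc, hfib⟩ := exists_fibration fun p => (a p).val
  have hdvd : ∀ D : Finset (Fin m × Option (Fin n)), ∑ p ∈ D, a p = 0 →
      q ∣ (Finset.univ.filter fun v => loc v ∈ D).card := fun D hD => by
    rw [← ZMod.natCast_eq_zero_iff, hfib, Nat.cast_sum]
    simpa using hD
  let col : Fin n → Finset (Fin m × Option (Fin n)) := fun j => Finset.univ ×ˢ {some j}
  let cell : Fin m → Finset (Fin n) → Finset (Fin m × Option (Fin n)) := fun i S =>
    {i} ×ˢ insert none (S.map Function.Embedding.some)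
  have hcol : ∀ j, ∑ p ∈ col j, a p = 0 := fun j => by
    simp only [col, Finset.sum_product, Finset.sum_singleton]
    exact hy j
  have hcell : ∀ i S, ∑ j ∈ S, A i j = b i → ∑ p ∈ cell i S, a p = 0 := fun i S hS => by
    simp only [cell, Finset.sum_product, Finset.sum_singleton]
    rw [Finset.sum_insert (by simp), Finset.sum_map]
    change -(y i * b i) + ∑ j ∈ S, y i * A i j = 0
    rw [← Finset.mul_sum, hS, neg_add_cancel]
  -- One partition is fixed for each set of positions of weight zero; the condition sits inside the
  -- existential so that `B` can be chosen as a total function.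
  have hB : ∀ D : Finset (Fin m × Option (Fin n)), ∃ B : Finset (Finset (Fin N)),
      ∑ p ∈ D, a p = 0 → (∀ v, loc v ∈ D → ∃ e ∈ B, v ∈ e) ∧
        (∀ e ∈ B, e.card = q ∧ ∀ v ∈ e, loc v ∈ D) ∧ ∀ e ∈ B, ∀ f ∈ B, ¬ Conflict e f :=
    fun D => by
      by_cases hD : ∑ p ∈ D, a p = 0
      · obtain ⟨B, h1, h2, h3⟩ := exists_partition_blocks _ (hdvd D hD)
        exact ⟨B, fun _ => ⟨fun v hv => h1 v (by simpa using hv),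
          fun e he => ⟨(h2 e he).1, fun v hv => by simpa using (h2 e he).2 hv⟩, h3⟩⟩
      · exact ⟨∅, fun h => absurd h hD⟩
  choose B hB using hB
  -- The pair `({j}, ∅)` says that x_j is false; `(rowSupport A i, S)` fixes the whole row to a
  -- satisfying assignment.
  let t : Finset (Fin N) → List (Finset (Fin n) × Finset (Fin n)) := fun e =>
    ((Finset.univ.filter fun j => e ∈ B (col j)).toList.map fun j => ({j}, ∅)) ++
    (List.finRange m).flatMap fun i =>
      (((rowSupport A i).powerset.filter fun S =>
        ∑ j ∈ S, A i j = b i ∧ e ∈ B (cell i S)).toList.map fun S => (rowSupport A i, S))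
  have mem_t : ∀ {e p}, p ∈ t e ↔ (∃ j, e ∈ B (col j) ∧ ({j}, ∅) = p) ∨
      ∃ i S, (S ⊆ rowSupport A i ∧ ∑ j ∈ S, A i j = b i ∧ e ∈ B (cell i S)) ∧
        (rowSupport A i, S) = p := fun {e p} => by
    simp [t]
  have mem_col : ∀ {v j}, loc v ∈ col j ↔ (loc v).2 = some j := fun {v j} => by
    rcases hv : loc v with ⟨i', _ | j'⟩ <;> simp [col, eq_comm]
  have mem_cell : ∀ {v i S}, loc v ∈ cell i S ↔
      (loc v).1 = i ∧ ∀ j, (loc v).2 = some j → j ∈ S := fun {v i S} => by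
    rcases hv : loc v with ⟨i', _ | j⟩ <;> simp [cell, and_comm, eq_comm]
  -- A point common to a column block and a row block lies in column `j`, which the row block admits
  -- only if x_j is true; the column block requires x_j false.
  have col_cell : ∀ {e f j i S}, Conflict e f → e ∈ B (col j) → S ⊆ rowSupport A i →
      ∑ j ∈ S, A i j = b i → f ∈ B (cell i S) → j ∈ S := fun {e f j i S} hef he _ hSb hf => by
    obtain ⟨v, hve, hvf⟩ := Finset.not_disjoint_iff.1 hef.2
    have h1 := mem_col.1 (((hB _ (hcol j)).2.1 e he).2 v hve)
    exact (mem_cell.1 (((hB _ (hcell i S hSb)).2.1 f hf).2 v hvf)).2 j h1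
  refine ⟨N, t, ?_, ?_, fun e => ?_, fun e f hef p hp r hr => ?_, fun v => ⟨(loc v).1, ?_⟩⟩
  -- Modulo `q` the column sums vanish, and only the right-hand sides contribute to N.
  · rw [← ZMod.natCast_eq_zero_iff, hN, Nat.cast_sum]
    simp only [ZMod.natCast_val, ZMod.cast_id', id_eq, Fintype.sum_prod_type,
      Fintype.sum_option, a, Option.elim]
    rw [Finset.sum_add_distrib, Finset.sum_comm, Finset.sum_eq_zero fun j _ => hy j, add_zero,
      Finset.sum_neg_distrib, neg_eq_zero]
    exact hyb
  · rw [hN]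
    refine (Finset.sum_le_card_nsmul _ _ q fun p _ => (ZMod.val_lt _).le).trans ?_
    simp
  · simp only [t, List.length_append, List.length_map, Finset.length_toList, List.length_flatMap]
    refine Nat.add_le_add ((Finset.card_le_univ _).trans (by simp)) ?_
    refine (List.sum_le_card_nsmul _ (2 ^ width A) fun x hx => ?_).trans (by simp)
    obtain ⟨i, -, rfl⟩ := List.mem_map.1 hx
    refine (Finset.card_filter_le _ _).trans ?_
    rw [Finset.card_powerset]
    exact Nat.pow_le_pow_right (by norm_num)
      (Finset.le_sup (f := fun i => (rowSupport A i).card) (Finset.mem_univ i))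
  · have hef' : Conflict f e := ⟨hef.1.symm, fun h => hef.2 h.symm⟩
    obtain ⟨v, hve, hvf⟩ := Finset.not_disjoint_iff.1 hef.2
    rcases mem_t.1 hp with ⟨j, hj, rfl⟩ | ⟨i, S, ⟨hS, hSb, hj⟩, rfl⟩ <;>
      rcases mem_t.1 hr with ⟨j', hj', rfl⟩ | ⟨i', S', ⟨hS', hSb', hj'⟩, rfl⟩
    · have h1 := mem_col.1 (((hB _ (hcol j)).2.1 e hj).2 v hve)
      have h2 := mem_col.1 (((hB _ (hcol j')).2.1 f hj').2 v hvf)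
      obtain rfl : j = j' := Option.some.inj (h1.symm.trans h2)
      exact absurd hef ((hB _ (hcol j)).2.2 e hj f hj')
    · have := col_cell hef hj hS' hSb' hj'
      exact ⟨j, by simp, hS' this, by simp [this]⟩
    · have := col_cell hef' hj' hS hSb hj
      exact ⟨j', hS this, by simp, by simp [this]⟩
    · have h1 := (mem_cell.1 (((hB _ (hcell i S hSb)).2.1 e hj).2 v hve)).1
      have h2 := (mem_cell.1 (((hB _ (hcell i' S' hSb')).2.1 f hj').2 v hvf)).1
      obtain rfl : i = i' := h1.symm.trans h2
      -- Blocks of the same partition never conflict, and distinct assignments to the same row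
      -- differ at a variable of its support.
      by_cases hSS : S = S'
      · subst hSS
        exact absurd hef ((hB _ (hcell i S hSb)).2.2 e hj f hj')
      · by_contra hcon
        refine hSS (Finset.ext fun j => ?_)
        by_cases hjT : j ∈ rowSupport A i
        · by_contra hne
          exact hcon ⟨j, hjT, hjT, by dsimp only; tauto⟩
        · exact ⟨fun hjS => absurd (hS hjS) hjT, fun hjS => absurd (hS' hjS) hjT⟩
  · intro S hS
    by_cases hSb : ∑ j ∈ S, A (loc v).1 j = b (loc v).1
    · right
      -- A point in a column with false variable is covered by the column partition, any other point
      -- by the row partition.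
      by_cases hv : ∃ j, (loc v).2 = some j ∧ j ∉ S
      · obtain ⟨j, hj, hjS⟩ := hv
        obtain ⟨e, he, hve⟩ := (hB _ (hcol j)).1 v (mem_col.2 hj)
        refine ⟨e, mem_star.2 ⟨((hB _ (hcol j)).2.1 e he).1, hve⟩, _,
          mem_t.2 (Or.inl ⟨j, he, rfl⟩), ?_, by simpa using hjS⟩
        rw [Finset.singleton_subset_iff, mem_rowSupport]
        -- With a zero coefficient the position would contain no points.
        intro hA
        refine hloc v ?_
        simp [a, hj, hA]
      · push Not at hv
        obtain ⟨e, he, hve⟩ := (hB _ (hcell _ S hSb)).1 v (mem_cell.2 ⟨rfl, hv⟩)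
        exact ⟨e, mem_star.2 ⟨((hB _ (hcell _ S hSb)).2.1 e he).1, hve⟩, _,
          mem_t.2 (Or.inr ⟨_, S, ⟨hS, hSb, he⟩, rfl⟩), le_rfl, fun j _ => Iff.rfl⟩
    · exact Or.inl hSb

end LinearSystem

/-! ### Polynomial bounds and assembly -/

namespace LinearSystem

open PropFormula CountingFrege

/-- Polynomially bounded functions on the positive natural numbers. -/
def PolyBounded (f : ℕ → ℕ) : Prop := ∃ c, ∀ M, 1 ≤ M → f M ≤ c * M ^ c

namespace PolyBounded

variable {f g : ℕ → ℕ}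

theorem const (a : ℕ) : PolyBounded fun _ => a :=
  ⟨a, fun _ hM => Nat.le_mul_of_pos_right _ (Nat.pow_pos hM)⟩

theorem id : PolyBounded fun M => M := ⟨1, fun M _ => by simp⟩

theorem add (hf : PolyBounded f) (hg : PolyBounded g) : PolyBounded fun M => f M + g M := by
  obtain ⟨a, ha⟩ := hf
  obtain ⟨b, hb⟩ := hg
  refine ⟨a + b, fun M hM => ?_⟩
  rw [add_mul]
  exact Nat.add_le_add
    ((ha M hM).trans (Nat.mul_le_mul_left _ (Nat.pow_le_pow_right hM (by omega))))
    ((hb M hM).trans (Nat.mul_le_mul_left _ (Nat.pow_le_pow_right hM (by omega))))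

theorem mul (hf : PolyBounded f) (hg : PolyBounded g) : PolyBounded fun M => f M * g M := by
  obtain ⟨a, ha⟩ := hf
  obtain ⟨b, hb⟩ := hg
  -- The same constant must dominate the coefficient `a * b` and the exponent `a + b`.
  refine ⟨a * b + a + b, fun M hM => (Nat.mul_le_mul (ha M hM) (hb M hM)).trans ?_⟩
  rw [mul_mul_mul_comm, ← pow_add]
  exact Nat.mul_le_mul (by omega) (Nat.pow_le_pow_right hM (by omega))

theorem pow (hf : PolyBounded f) (k : ℕ) : PolyBounded fun M => f M ^ k := by
  induction k with
  | zero => simpa using const 1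
  | succ k ih => simpa only [pow_succ] using ih.mul hf

end PolyBounded

variable {q m n : ℕ}

theorem length_flatMap_rowClauses_le (A : Matrix (Fin m) (Fin n) (ZMod q)) (b : Fin m → ZMod q) :
    ((List.finRange m).flatMap (rowClauses A b)).length ≤ m * 2 ^ width A := by
  rw [List.length_flatMap]
  refine (List.sum_le_card_nsmul _ (2 ^ width A) fun x hx => ?_).trans (by simp)
  obtain ⟨i, -, rfl⟩ := List.mem_map.1 hx
  rw [rowClauses, List.length_map, Finset.length_toList]
  refine (Finset.card_filter_le _ _).trans ?_
  rw [Finset.card_powerset]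
  exact Nat.pow_le_pow_right (by norm_num)
    (Finset.le_sup (f := fun i => (rowSupport A i).card) (Finset.mem_univ i))

theorem mem_flatMap_rowClauses {A : Matrix (Fin m) (Fin n) (ZMod q)} {b : Fin m → ZMod q}
    {F : PropFormula (Fin n)} : F ∈ (List.finRange m).flatMap (rowClauses A b) ↔
      ∃ i S, (S ⊆ rowSupport A i ∧ ∑ j ∈ S, A i j ≠ b i) ∧
        excludingClause (rowSupport A i) S = F := by
  simp [rowClauses]

theorem clauseDerives_excludingClause (A : Matrix (Fin m) (Fin n) (ZMod q)) (b : Fin m → ZMod q)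
    {i : Fin m} {S : Finset (Fin n)} (hS : S ⊆ rowSupport A i) (hSb : ∑ j ∈ S, A i j ≠ b i)
    {l s d : ℕ} (hl : m * 2 ^ width A + 2 ≤ l) (hs : m * 2 ^ width A * (2 * n + 2) + 2 ≤ s)
    (hd : 5 ≤ d) :
    ClauseDerives q {explicitEncoding A b} l s d 16 [excludingClause (rowSupport A i) S] := by
  have hlen := length_flatMap_rowClauses_le A b
  have hmem : excludingClause (rowSupport A i) S ∈ (List.finRange m).flatMap (rowClauses A b) :=
    mem_flatMap_rowClauses.2 ⟨i, S, ⟨hS, hSb⟩, rfl⟩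
  have hpos : 2 * n + 2 ≤ m * 2 ^ width A * (2 * n + 2) :=
    Nat.le_mul_of_pos_left _ ((List.length_pos_of_mem hmem).trans_le hlen)
  refine clauseDerives_of_conj_mem (Cs := (List.finRange m).flatMap (rowClauses A b))
    (Set.mem_singleton _) hmem ?_ ?_ ?_ ?_
  · omega
  · rw [conj, size_neg]
    refine (Nat.add_le_add_right (size_disj_le (s := 2 * n + 2)
      (by rwa [List.length_map]) fun F hF => ?_) 1).trans hs
    obtain ⟨G, hG, rfl⟩ := List.mem_map.1 hF
    obtain ⟨i, S, -, rfl⟩ := mem_flatMap_rowClauses.1 hG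
    rw [size_neg]
    exact Nat.add_le_add_right (size_excludingClause_le _ _) 1
  · intro F hF
    obtain ⟨i, S, -, rfl⟩ := mem_flatMap_rowClauses.1 hF
    have := depth_excludingClause_le (rowSupport A i) S
    omega
  · intro F hF
    obtain ⟨i, S, -, rfl⟩ := mem_flatMap_rowClauses.1 hF
    have := size_excludingClause_le (rowSupport A i) S
    omega

/-- Bound for the number of points. -/
def pointBound (q M : ℕ) : ℕ := M * (M + 1) * q

/-- Bound for the number of partial assignments attached to a set of points. -/
def termBound (M : ℕ) : ℕ := M + M * M

/-- Bound for the length of clauses. -/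
def lengthBound (q M : ℕ) : ℕ :=
  pointBound q M + pointBound q M ^ q * pointBound q M ^ q + pointBound q M ^ q + termBound M +
    2 * M + M * M + 4

/-- Bound for the size of the members of clauses. -/
def sizeBound (q M : ℕ) : ℕ :=
  pointBound q M ^ q * (termBound M * (2 * M + 2) + 3) + 2 * (termBound M * (2 * M + 2)) +
    2 * M + M * M * (2 * M + 2) + 10

/-- Bound for the number of lines. -/
def lineBound (q M : ℕ) : ℕ :=
  4 + (pointBound q M + pointBound q M ^ q * pointBound q M ^ q) *
    (M * 30 + 7 + termBound M * (34 * (termBound M + 1)) + 10)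

/-- The function is the number of lines times the maximal line size of `ClauseDerives`; the exponent
`q` is a constant. -/
theorem polyBounded_total (q : ℕ) :
    PolyBounded fun M => lineBound q M * (3 * (lengthBound q M * sizeBound q M) + 5) := by
  have hN : PolyBounded (pointBound q) := (PolyBounded.id.mul (PolyBounded.id.add (.const 1))).mul
    (.const q)
  have hk : PolyBounded termBound := PolyBounded.id.add (PolyBounded.id.mul .id)
  have hNq := hN.pow q
  have h2 : PolyBounded fun M => 2 * M := (PolyBounded.const 2).mul .id
  have hM : PolyBounded fun M => M * M := PolyBounded.id.mul .id
  have hk2 := hk.mul (h2.add (.const 2))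
  have hl : PolyBounded (lengthBound q) :=
    (((((hN.add (hNq.mul hNq)).add hNq).add hk).add h2).add hM).add (.const 4)
  have hs : PolyBounded (sizeBound q) :=
    ((((hNq.mul (hk2.add (.const 3))).add ((PolyBounded.const 2).mul hk2)).add h2).add
      (hM.mul (h2.add (.const 2)))).add (.const 10)
  have hL : PolyBounded (lineBound q) :=
    (PolyBounded.const 4).add ((hN.add (hNq.mul hNq)).mul
      ((((PolyBounded.id.mul (.const 30)).add (.const 7)).add
        (hk.mul ((PolyBounded.const 34).mul (hk.add (.const 1))))).add (.const 10)))
  exact hL.mul (((PolyBounded.const 3).mul (hl.mul hs)).add (.const 5))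

theorem clauseDerives_nil [Fact q.Prime] (A : Matrix (Fin m) (Fin n) (ZMod q))
    (b : Fin m → ZMod q) (h : ¬ ∃ x : Fin n → ZMod q, A.mulVec x = b) {M : ℕ}
    (hM : m + n + 2 ^ width A = M) :
    ClauseDerives q {explicitEncoding A b} (lengthBound q M) (sizeBound q M) 8
      (lineBound q M) [] := by
  obtain ⟨N, t, hqN, hN, ht, hconf, hcov⟩ := exists_partial_assignments A b h
  have hpow : 0 < 2 ^ width A := Nat.two_pow_pos _
  have hmM : m ≤ M := by omega
  have hnM : n ≤ M := by omega
  have hwM : 2 ^ width A ≤ M := by omega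
  have hmw : m * 2 ^ width A ≤ M * M := Nat.mul_le_mul hmM hwM
  have hN' : N ≤ pointBound q M := hN.trans
    (Nat.mul_le_mul_right _ (Nat.mul_le_mul hmM (by omega)))
  have hNq : N ^ q ≤ pointBound q M ^ q := Nat.pow_le_pow_left hN' q
  have hNqq := Nat.mul_le_mul hNq hNq
  have hk : ∀ e, (t e).length ≤ termBound M := fun e => (ht e).trans (by unfold termBound; omega)
  have hkn : termBound M * (2 * n + 2) ≤ termBound M * (2 * M + 2) :=
    Nat.mul_le_mul_left _ (by omega)
  have hNkn : N ^ q * (termBound M * (2 * n + 2) + 3) ≤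
      pointBound q M ^ q * (termBound M * (2 * M + 2) + 3) :=
    Nat.mul_le_mul hNq (by omega)
  have hmn : m * 2 ^ width A * (2 * n + 2) ≤ M * M * (2 * M + 2) :=
    Nat.mul_le_mul hmw (by omega)
  -- Covering a point takes 2^|T| · (20 + 10) lines for the support T of its row, and 2^|T| ≤ M.
  refine (clauseDerives_refute (L := M * 30) hqN t hk hconf (fun v => ?_)
    (by unfold lengthBound; omega) (by unfold sizeBound; omega) le_rfl).mono ?_
  · obtain ⟨i, hi⟩ := hcov v
    refine (clauseDerives_cover (L := 20) v t hk (rowSupport A i) le_rfl (fun S hS => ?_)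
      (by unfold lengthBound; omega) (by unfold sizeBound; omega) (by norm_num)).mono ?_
    · refine (hi S hS).imp_left fun hSb => ?_
      exact (clauseDerives_excludingClause A b hS hSb (by unfold lengthBound; omega)
        (by unfold sizeBound; omega) (by norm_num)).mono (by norm_num)
    · refine Nat.mul_le_mul_right _ ((Nat.pow_le_pow_right (by norm_num) ?_).trans hwM)
      exact Finset.le_sup (f := fun i => (rowSupport A i).card) (Finset.mem_univ i)
  · exact Nat.add_le_add_left (Nat.mul_le_mul_right _ (by omega)) _

end LinearSystem

theorem mainTheorem4 (q : ℕ) (hq : q.Prime) :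
    ∃ c d : ℕ, ∀ (m n : ℕ) (A : Matrix (Fin m) (Fin n) (ZMod q)) (b : Fin m → ZMod q),
      (¬ ∃ x : Fin n → ZMod q, A.mulVec x = b) →
      ∃ π : List (PropFormula (Fin n)),
        CountingFrege.IsRefutation q {LinearSystem.explicitEncoding A b} π ∧
        (∀ F ∈ π, F.depth ≤ d) ∧
        CountingFrege.derivationSize π ≤ c * (m + n + 2 ^ LinearSystem.width A) ^ c := by
  have : Fact q.Prime := ⟨hq⟩
  obtain ⟨c, hc⟩ := LinearSystem.polyBounded_total q
  -- Clause members have depth at most 8, attained by the bound for a negated `covered` formula;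
  -- lines may be two levels deeper.
  refine ⟨c, 10, fun m n A b h => ?_⟩
  obtain ⟨π, h1, h2, h3⟩ := (LinearSystem.clauseDerives_nil A b h rfl).2.exists_refutation
  exact ⟨π, h1, h2, h3.trans (hc _ (Nat.one_le_two_pow.trans (Nat.le_add_left _ _)))⟩
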